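/- For integers $d, a, n \ge 1$ let $q_d^{(a)}(n)$ be the number of partitions of $n$ into parts that are all at least $a$ and any two of which (counted with multiplicity) differ by at least $d$. For $1 \le b \le d+2$ let $Q_d^{(b,-)}(n)$ be the number of partitions of $n$ into parts congruent to $\pm b \pmod{d+3}$, none of which is equal to $d+3-b$. Put $$\Delta_d^{(a,b,-)}(n) = q_d^{(a)}(n) - Q_d^{(b,-)}(n).$$ Then for all integers $d \ge 31$ and $n \ge d+6$, $$\Delta_{3d}^{(3,3,-)}(n) \ge 0.$$ Explicitly: the number of partitions of $n$ into parts $\ge 3$ that differ pairwise by at least $3d$ is at least the number of partitions of $n$ into parts congruent to $\pm 3 \pmod{3d+3}$ that do not use the part $3d$. -/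

import Mathlib

/-- `q_d^{(a)}(n)`: the number of partitions of `n` into parts that are all at least `a` and that
pairwise differ by at least `d` (the parts are listed in non-increasing order, so for `d ≥ 1`
they are in particular distinct). -/
def gapPartitionCount (d a n : ℕ) : ℕ :=
  Fintype.card {p : n.Partition //
    (∀ i ∈ p.parts, a ≤ i) ∧ (p.parts.sort (· ≥ ·)).Pairwise (fun x y => y + d ≤ x)}

/-- `Q_d^{(b,-)}(n)`: the number of partitions of `n` into parts congruent to `± b` modulo
`d + 3`, none of which equals `d + 3 - b` (meant for `1 ≤ b ≤ d + 2`). -/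
def congPartitionCountMinus (d b n : ℕ) : ℕ :=
  Fintype.card {p : n.Partition //
    ∀ i ∈ p.parts,
      ((i : ℤ) ≡ (b : ℤ) [ZMOD ((d : ℤ) + 3)] ∨ (i : ℤ) ≡ -(b : ℤ) [ZMOD ((d : ℤ) + 3)]) ∧
        (i : ℤ) ≠ (d : ℤ) + 3 - (b : ℤ)}

/-- `Δ_d^{(a,b,-)}(n) = q_d^{(a)}(n) - Q_d^{(b,-)}(n)`, an integer. -/
def deltaMinus (d a b n : ℕ) : ℤ :=
  (gapPartitionCount d a n : ℤ) - (congPartitionCountMinus d b n : ℤ)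

/-! If `3 ∤ n`, no partition of the congruence type exists. So let `n = 3m` and measure size by `M =
⌊2m/(2d+1)⌋`.

The admissible parts are `3` and, on each level `i ≥ 1`, `3(i(d+1) ± 1)`, with `3d` missing on level
1. A part of level `i` is at least `3i(d + 1/2)`, so the levels in a partition add up to at most
`M`, while the multiplicity of `3` is forced by the sum. Rankin's trick then bounds the congruence
count by `(1-x) x^(-M) ∏ (1-x^i)^(-2)` for every `0 < x < 1` (`congPartitionCountMinus_le`). With `x
= k/(k+2)` and `k` near `√M` this is at most `39^k/4`.

For gap partitions it suffices to fix the number of parts: `k + 1` parts with excess `N` over the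
minimal sum give at least `N^k/((k+1)! k!)` of them (`pow_le_gapPartitionCount`). With about `√M`
parts and `d ≥ 31` this grows roughly like `(93e²/2)^√M`, which beats `39^√M`. The ranges `M ≤ 1`,
`2 ≤ M ≤ 8` and `9 ≤ M ≤ 15` use few parts and cruder bounds. -/

/-! ### Lower bound for gap partitions. -/

/-- Lists of `k` numbers `≥ a`, increasing with gaps at least `D`, of sum `n`. -/
def IsGapList (D k a n : ℕ) (l : List ℕ) : Prop :=
  l.length = k ∧ l.sum = n ∧ (∀ i ∈ l, a ≤ i) ∧ l.Pairwise (fun x y => x + D ≤ y)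

theorem IsGapList.cons {D k a n : ℕ} {l : List ℕ} (h : IsGapList D k (a + D) n l) :
    IsGapList D (k + 1) a (a + n) (a :: l) := by
  obtain ⟨h1, h2, h3, h4⟩ := h
  refine ⟨by simp [h1], by simp [h2], ?_, List.pairwise_cons.2 ⟨h3, h4⟩⟩
  intro i hi
  rcases List.mem_cons.1 hi with rfl | hi
  · exact le_rfl
  · have := h3 i hi
    omega

theorem IsGapList.mono {D k a b n : ℕ} {l : List ℕ} (hab : a ≤ b) (h : IsGapList D k b n l) :
    IsGapList D k a n l :=
  ⟨h.1, h.2.1, fun i hi => hab.trans (h.2.2.1 i hi), h.2.2.2⟩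

/-- Any finite family of gap lists gives a lower bound for the number of gap partitions. -/
theorem card_le_gapPartitionCount {D a n : ℕ} (hD : 0 < D) (ha : 0 < a) (F : Finset (List ℕ))
    (hF : ∀ l ∈ F, ∃ k, IsGapList D k a n l) : F.card ≤ gapPartitionCount D a n := by
  classical
  have key : ∀ l ∈ F, ∃ p : {p : n.Partition //
      (∀ i ∈ p.parts, a ≤ i) ∧ (p.parts.sort (· ≥ ·)).Pairwise (fun x y => y + D ≤ x)},
      p.1.parts = (l : Multiset ℕ) := by
    intro l hl
    obtain ⟨k, -, h2, h3, h4⟩ := hF l hl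
    refine ⟨⟨⟨(l : Multiset ℕ), fun {i} hi => ha.trans_le (h3 i (by simpa using hi)), by simpa⟩,
      fun i hi => h3 i (by simpa using hi), ?_⟩, rfl⟩
    have hs : (l : Multiset ℕ).sort (· ≥ ·) = l.reverse := by
      refine List.Perm.eq_of_pairwise' (r := (· ≥ ·)) (Multiset.pairwise_sort _ _) ?_ ?_
      · rw [List.pairwise_reverse]
        exact h4.imp (fun h => by omega)
      · rw [← Multiset.coe_eq_coe]
        exact Multiset.sort_eq _ _ |>.trans (Multiset.coe_reverse l).symm
    change ((l : Multiset ℕ).sort (· ≥ ·)).Pairwise _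
    rw [hs, List.pairwise_reverse]
    exact h4
  choose f hf using key
  unfold gapPartitionCount
  rw [← Finset.card_univ, ← F.card_attach]
  refine Finset.card_le_card_of_injOn (fun l => f l.1 l.2)
    (fun _ _ => Finset.mem_coe.2 (Finset.mem_univ _)) ?_
  rintro ⟨l, hl⟩ - ⟨l', hl'⟩ - h
  have hp : (l : Multiset ℕ) = l' := by
    rw [← hf l hl, ← hf l' hl']
    exact congrArg (fun p => p.1.parts) h
  refine Subtype.ext ?_
  obtain ⟨k, -, -, -, h4⟩ := hF l hl
  obtain ⟨k', -, -, -, h4'⟩ := hF l' hl'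
  exact List.Perm.eq_of_pairwise' (r := (· ≤ ·)) (h4.imp (fun h => by omega))
    (h4'.imp (fun h => by omega)) (Multiset.coe_eq_coe.1 hp)

/-- Bernoulli's inequality for `(N/X)^(k+1) = (1 - (k+2)/X)^(k+1)`, where `X = N + k + 2`. It is the
induction step of `exists_gapLists`. -/
theorem pow_succ_le_recursion (k N : ℕ) :
    ((N : ℝ) + (k + 2)) ^ (k + 1) ≤
      (k + 2) * (k + 1) * ((N : ℝ) + (k + 2)) ^ k + (N : ℝ) ^ (k + 1) := by
  have hN : (0 : ℝ) ≤ N := N.cast_nonneg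
  have hpos : (0 : ℝ) < (N : ℝ) + (k + 2) := by positivity
  set X : ℝ := (N : ℝ) + (k + 2) with hX
  have hb := one_add_mul_le_pow (a := -((k + 2 : ℝ) / X))
    (by
      have : (k + 2 : ℝ) / X ≤ 1 := by
        rw [div_le_one hpos]; linarith
      linarith) (k + 1)
  have he : 1 + -((k + 2 : ℝ) / X) = N / X := by
    field_simp
    rw [hX]; ring
  rw [he, div_pow, le_div_iff₀ (by positivity)] at hb
  push_cast at hb
  have : (1 + ((k : ℝ) + 1) * -((k + 2 : ℝ) / X)) * X ^ (k + 1)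
      = X ^ (k + 1) - (k + 2) * (k + 1) * X ^ k := by
    rw [pow_succ]
    field_simp
    ring
  linarith

/-- There are at least `N ^ k / ((k + 1)! k!)` gap lists with `k + 1` parts, where `N` is the excess
of the sum over its minimal value. -/
theorem exists_gapLists (D k : ℕ) : ∀ N a : ℕ, ∃ F : Finset (List ℕ),
    (∀ l ∈ F, IsGapList D (k + 1) a (N + (k + 1) * a + D * (k + 1).choose 2) l) ∧
    N ^ k ≤ (k + 1).factorial * k.factorial * F.card := by
  classical
  induction k with
  | zero =>
    intro N a
    refine ⟨{[a + N]}, ?_, by simp⟩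
    intro l hl
    rw [Finset.mem_singleton] at hl
    subst hl
    simp [IsGapList, add_comm]
  | succ k ih =>
    intro N
    induction N using Nat.strong_induction_on with
    | _ N ihN =>
    intro a
    -- Either the smallest part is `a`, and the others form a list above `a + D` with the same
    -- excess (`F₁`), or all `k + 2` parts are at least `a + 1`, and the excess drops by `k + 2`
    -- (`F₂`).
    obtain ⟨F₁, hF₁, hc₁⟩ := ih N (a + D)
    have hchoose : (k + 1 + 1).choose 2 = (k + 1) + (k + 1).choose 2 := by
      rw [Nat.choose_succ_succ' (k + 1) 1, Nat.choose_one_right]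
    have hF₁' : ∀ l ∈ F₁.image (a :: ·),
        IsGapList D (k + 1 + 1) a (N + (k + 1 + 1) * a + D * (k + 1 + 1).choose 2) l := by
      intro l hl
      obtain ⟨l, hl', rfl⟩ := Finset.mem_image.1 hl
      have := (hF₁ l hl').cons
      convert this using 1
      rw [hchoose]
      ring
    have hcard : (F₁.image (a :: ·)).card = F₁.card :=
      Finset.card_image_of_injective _ (List.cons_injective)
    have hf1 : (k + 1 + 1).factorial * (k + 1).factorial
        = ((k + 2) * (k + 1)) * ((k + 1).factorial * k.factorial) := by
      rw [Nat.factorial_succ (k + 1), Nat.factorial_succ k]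
      ring
    -- Here the excess is too small to raise every part, and `F₁` alone suffices because `N ≤
    -- (k+2)(k+1)`.
    by_cases hN : N < k + 2
    · refine ⟨_, hF₁', ?_⟩
      rw [hcard, hf1, mul_assoc, pow_succ, mul_comm]
      refine Nat.mul_le_mul ?_ hc₁
      nlinarith
    · obtain ⟨N', rfl⟩ := Nat.exists_eq_add_of_le (not_lt.1 hN)
      obtain ⟨F₂, hF₂, hc₂⟩ := ihN N' (by omega) (a + 1)
      refine ⟨F₁.image (a :: ·) ∪ F₂, ?_, ?_⟩
      · intro l hl
        rcases Finset.mem_union.1 hl with hl | hl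
        · exact hF₁' l hl
        · have := (hF₂ l hl).mono (Nat.le_succ a)
          convert this using 1
          ring
      · have hdisj : Disjoint (F₁.image (a :: ·)) F₂ := by
          rw [Finset.disjoint_left]
          intro l hl hl2
          obtain ⟨l, -, rfl⟩ := Finset.mem_image.1 hl
          have := (hF₂ _ hl2).2.2.1 a (by simp)
          omega
        rw [Finset.card_union_of_disjoint hdisj, hcard, mul_add]
        have hrec : (k + 2 + N') ^ (k + 1) ≤
            (k + 2) * (k + 1) * (k + 2 + N') ^ k + N' ^ (k + 1) := by
          have := pow_succ_le_recursion k N'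
          rw [add_comm] at this
          exact_mod_cast this
        refine hrec.trans (Nat.add_le_add ?_ hc₂)
        rw [hf1, mul_assoc ((k + 2) * (k + 1))]
        exact Nat.mul_le_mul_left _ hc₁

theorem pow_le_gapPartitionCount {D a : ℕ} (hD : 0 < D) (ha : 0 < a) (k N n : ℕ)
    (hn : n = N + (k + 1) * a + D * (k + 1).choose 2) :
    N ^ k ≤ (k + 1).factorial * k.factorial * gapPartitionCount D a n := by
  obtain ⟨F, hF, hc⟩ := exists_gapLists D k N a
  refine hc.trans (Nat.mul_le_mul_left _ (card_le_gapPartitionCount hD ha F ?_))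
  intro l hl
  exact ⟨k + 1, hn ▸ hF l hl⟩

/-! ### Rankin-type upper bound, one part size at a time. -/

/-- Every family of multisets with elements in `S` and sum `n` has at most `A * y ^ φ n` members. -/
def SumCountBound (S : Set ℕ) (φ : ℕ → ℕ) (y A : ℝ) : Prop :=
  ∀ (n : ℕ) (F : Finset (Multiset ℕ)), (∀ s ∈ F, s.sum = n ∧ ∀ i ∈ s, i ∈ S) →
    (F.card : ℝ) ≤ A * y ^ φ n

/-- Splitting a family of multisets according to whether `t` occurs. -/
theorem exists_families_of_insert {S : Set ℕ} {t n : ℕ} (F : Finset (Multiset ℕ))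
    (hF : ∀ s ∈ F, s.sum = n ∧ ∀ i ∈ s, i ∈ insert t S) :
    ∃ F₁ F₂ : Finset (Multiset ℕ), F.card = F₁.card + F₂.card ∧
      (∀ s ∈ F₁, s.sum = n ∧ ∀ i ∈ s, i ∈ S) ∧
      (∀ s ∈ F₂, t ≤ n ∧ s.sum = n - t ∧ ∀ i ∈ s, i ∈ insert t S) := by
  classical
  refine ⟨F.filter (t ∉ ·), (F.filter (t ∈ ·)).image (·.erase t), ?_, ?_, ?_⟩
  · rw [Finset.card_image_of_injOn, add_comm, Finset.card_filter_add_card_filter_not]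
    intro s hs s' hs' h
    rw [Finset.mem_coe, Finset.mem_filter] at hs hs'
    rw [← Multiset.cons_erase hs.2, ← Multiset.cons_erase hs'.2]
    exact congrArg _ h
  · intro s hs
    rw [Finset.mem_filter] at hs
    refine ⟨(hF s hs.1).1, fun i hi => ?_⟩
    rcases (hF s hs.1).2 i hi with rfl | h
    · exact absurd hi hs.2
    · exact h
  · intro s hs
    obtain ⟨s, hs', rfl⟩ := Finset.mem_image.1 hs
    replace hs := Finset.mem_filter.1 hs'
    have h1 := Multiset.sum_erase hs.2
    have h2 := (hF s hs.1).1
    exact ⟨by omega, by omega, fun i hi => (hF s hs.1).2 i (Multiset.mem_of_mem_erase hi)⟩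

/-- Removing one copy of `t` lowers `φ` by at least `j`, so the new constant `B` only has to satisfy
`A + B x^j = B`. -/
theorem SumCountBound.insert {S : Set ℕ} {φ : ℕ → ℕ} {x A : ℝ} (hS : SumCountBound S φ x⁻¹ A)
    (hx0 : 0 < x) (hx1 : x < 1) (hA : 0 ≤ A) {t j : ℕ} (ht : 0 < t) (hj : 0 < j)
    (hφ : ∀ n, t ≤ n → φ (n - t) + j ≤ φ n) :
    SumCountBound (insert t S) φ x⁻¹ (A / (1 - x ^ j)) := by
  intro n
  induction n using Nat.strong_induction_on with
  | _ n ih =>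
  intro F hF
  have hxj : x ^ j < 1 := pow_lt_one₀ hx0.le hx1 hj.ne'
  have hpos : 0 < 1 - x ^ j := by linarith
  have hB : 0 ≤ A / (1 - x ^ j) := div_nonneg hA hpos.le
  obtain ⟨F₁, F₂, hcard, h1, h2⟩ := exists_families_of_insert F hF
  have hc1 := hS n F₁ h1
  have hy : (1 : ℝ) ≤ x⁻¹ := (one_le_inv₀ hx0).2 hx1.le
  have hc2 : (F₂.card : ℝ) ≤ A / (1 - x ^ j) * (x ^ j * x⁻¹ ^ φ n) := by
    rcases F₂.eq_empty_or_nonempty with rfl | ⟨s, hs⟩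
    · simp only [Finset.card_empty, Nat.cast_zero]
      positivity
    · have htn := (h2 s hs).1
      refine (ih (n - t) (by omega) F₂ (fun s hs => (h2 s hs).2)).trans ?_
      refine mul_le_mul_of_nonneg_left ?_ hB
      have h3 : x⁻¹ ^ (φ (n - t) + j) ≤ x⁻¹ ^ φ n := pow_le_pow_right₀ hy (hφ n htn)
      calc x⁻¹ ^ φ (n - t) = x ^ j * x⁻¹ ^ (φ (n - t) + j) := by
            rw [pow_add, inv_pow x j]
            field_simp
        _ ≤ _ := mul_le_mul_of_nonneg_left h3 (by positivity)
  rw [hcard, Nat.cast_add]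
  calc (F₁.card : ℝ) + F₂.card
      ≤ A * x⁻¹ ^ φ n + A / (1 - x ^ j) * (x ^ j * x⁻¹ ^ φ n) := add_le_add hc1 hc2
    _ = A / (1 - x ^ j) * x⁻¹ ^ φ n := by
        field_simp
        ring

theorem card_le_one_of_forall_eq {n t : ℕ} (ht : 0 < t) (F : Finset (Multiset ℕ))
    (hF : ∀ s ∈ F, s.sum = n ∧ ∀ i ∈ s, i = t) : F.card ≤ 1 := by
  rw [Finset.card_le_one]
  have key : ∀ s ∈ F, s = Multiset.replicate (n / t) t := by
    intro s hs
    obtain ⟨h1, h2⟩ := hF s hs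
    have h3 := Multiset.eq_replicate_card.2 h2
    rw [h3, Multiset.sum_replicate, smul_eq_mul] at h1
    rw [← h1, Nat.mul_div_cancel _ ht]
    exact h3
  intro s hs s' hs'
  rw [key s hs, key s' hs']

/-! ### Parts by level and the bound for the congruence count. -/

/-- The parts `3` and `3 (i (d + 1) ± 1)` for `1 ≤ i ≤ J`, other than `3 d`. -/
def levelParts (d J : ℕ) : Set ℕ :=
  {t | t = 3 ∨ ∃ i, 1 ≤ i ∧ i ≤ J ∧
    (t = 3 * (i * (d + 1) + 1) ∨ 2 ≤ i ∧ t = 3 * (i * (d + 1) - 1))}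

theorem levelParts_one (d : ℕ) : levelParts d 1 = insert (3 * (d + 2)) {3} := by
  ext t
  simp only [levelParts, Set.mem_ofPred_eq, Set.mem_singleton_iff, Set.mem_insert_iff]
  constructor
  · rintro (h | ⟨i, h1, h2, h | h⟩)
    · exact Or.inr h
    · obtain rfl : i = 1 := by omega
      left; omega
    · omega
  · rintro (h | h)
    · exact Or.inr ⟨1, le_rfl, le_rfl, Or.inl (by omega)⟩
    · exact Or.inl h

theorem levelParts_succ (d : ℕ) {J : ℕ} (hJ : 1 ≤ J) : levelParts d (J + 1) =
    insert (3 * ((J + 1) * (d + 1) + 1))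
      (insert (3 * ((J + 1) * (d + 1) - 1)) (levelParts d J)) := by
  ext t
  simp only [levelParts, Set.mem_ofPred_eq, Set.mem_insert_iff]
  constructor
  · rintro (h | ⟨i, h1, h2, h⟩)
    · exact Or.inr (Or.inr (Or.inl h))
    · rcases Nat.lt_or_ge J i with hi | hi
      · obtain rfl : i = J + 1 := by omega
        rcases h with h | h
        · exact Or.inl h
        · exact Or.inr (Or.inl h.2)
      · exact Or.inr (Or.inr (Or.inr ⟨i, h1, hi, h⟩))
  · rintro (h | h | h | ⟨i, h1, h2, h⟩)
    · exact Or.inr ⟨J + 1, by omega, le_rfl, Or.inl h⟩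
    · exact Or.inr ⟨J + 1, by omega, le_rfl, Or.inr ⟨by omega, h⟩⟩
    · exact Or.inl h
    · exact Or.inr ⟨i, h1, by omega, h⟩

theorem div_sub_add_le {e t j n : ℕ} (he : 0 < e) (h : e * j ≤ 2 * t) (htn : t ≤ n) :
    2 * (n - t) / e + j ≤ 2 * n / e := by
  rw [← Nat.add_mul_div_left _ _ he]
  exact Nat.div_le_div_right (by omega)

/-- A part `t` of level `i` satisfies `2t ≥ (6d+3)i`; for `3(i(d+1) - 1)` this is exactly where `i ≥
2` is needed. Each level contributes two factors `(1-x^i)⁻¹`, and the missing `3d` accounts for the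
leading `1 - x`. -/
theorem sumCountBound_levelParts (d : ℕ) {x : ℝ} (hx0 : 0 < x) (hx1 : x < 1) {J : ℕ} (hJ : 1 ≤ J) :
    SumCountBound (levelParts d J) (fun n => 2 * n / (6 * d + 3)) x⁻¹
      ((1 - x) * ∏ i ∈ Finset.Icc 1 J, ((1 - x ^ i) ^ 2)⁻¹) := by
  have he : 0 < 6 * d + 3 := by omega
  have hpos : ∀ i, 1 ≤ i → 0 < 1 - x ^ i := fun i hi => by
    have := pow_lt_one₀ hx0.le hx1 (show i ≠ 0 by omega)
    linarith
  induction J, hJ using Nat.le_induction with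
  | base =>
    have h0 : SumCountBound {3} (fun n => 2 * n / (6 * d + 3)) x⁻¹ 1 := by
      intro n F hF
      have h1 : (F.card : ℝ) ≤ 1 := by
        exact_mod_cast card_le_one_of_forall_eq (t := 3) (by norm_num) F hF
      refine h1.trans ?_
      rw [one_mul]
      exact one_le_pow₀ ((one_le_inv₀ hx0).2 hx1.le)
    have h1 := h0.insert hx0 hx1 zero_le_one (t := 3 * (d + 2)) (j := 1) (by omega) one_pos
      (fun n hn => div_sub_add_le he (by omega) hn)
    rw [levelParts_one]
    convert h1 using 1
    have := hpos 1 le_rfl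
    rw [pow_one] at this
    simp only [Finset.Icc_self, Finset.prod_singleton, pow_one]
    field_simp
  | succ J hJ ih =>
    have hA : 0 ≤ (1 - x) * ∏ i ∈ Finset.Icc 1 J, ((1 - x ^ i) ^ 2)⁻¹ :=
      mul_nonneg (by linarith) (Finset.prod_nonneg fun i _ => by positivity)
    have hp := hpos (J + 1) (by omega)
    have hexp : (J + 1) * (d + 1) = J * d + J + d + 1 := by ring
    have hexp2 : (6 * d + 3) * (J + 1) = 6 * (J * d) + 3 * J + 6 * d + 3 := by ring
    have h1 := ih.insert hx0 hx1 hA (t := 3 * ((J + 1) * (d + 1) - 1)) (j := J + 1)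
      (by rw [hexp]; omega) (by omega) (fun n hn => div_sub_add_le he
        (by rw [hexp, hexp2]; omega) hn)
    have h2 := h1.insert hx0 hx1 (div_nonneg hA hp.le) (t := 3 * ((J + 1) * (d + 1) + 1))
      (j := J + 1) (by omega) (by omega) (fun n hn => div_sub_add_le he
        (by rw [hexp, hexp2]; omega) hn)
    rw [levelParts_succ d hJ]
    convert h2 using 1
    rw [Finset.prod_Icc_succ_top (by omega)]
    field_simp

theorem mem_levelParts_of_modEq {d i m : ℕ} (hi0 : 0 < i)
    (h : (i : ℤ) ≡ ((3 : ℕ) : ℤ) [ZMOD (((3 * d : ℕ) : ℤ) + 3)] ∨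
      (i : ℤ) ≡ -((3 : ℕ) : ℤ) [ZMOD (((3 * d : ℕ) : ℤ) + 3)])
    (hne : (i : ℤ) ≠ ((3 * d : ℕ) : ℤ) + 3 - ((3 : ℕ) : ℤ)) (hm : i ≤ 3 * m) (hd : 1 ≤ d) :
    i ∈ levelParts d (2 * m / (2 * d + 1)) := by
  have hle : ∀ c : ℕ, c * (2 * d + 1) ≤ 2 * m → c ≤ 2 * m / (2 * d + 1) := fun c hc =>
    (Nat.le_div_iff_mul_le (by omega)).2 hc
  push_cast at h hne
  rcases h with h | h
  · obtain ⟨c, hc⟩ := h.symm.dvd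
    have hi : (i : ℤ) = 3 * (c * (d + 1) + 1) := by linarith
    have hc0 : 0 ≤ c := by
      by_contra hc0
      have : c * ((d : ℤ) + 1) ≤ (-1) * ((d : ℤ) + 1) :=
        mul_le_mul_of_nonneg_right (by omega) (by omega)
      omega
    lift c to ℕ using hc0
    have hi' : i = 3 * (c * (d + 1) + 1) := by exact_mod_cast hi
    rcases Nat.eq_zero_or_pos c with rfl | hcpos
    · left; omega
    · refine Or.inr ⟨c, hcpos, hle c ?_, Or.inl hi'⟩
      have : c * (d + 1) = c * d + c := by ring
      have : c * (2 * d + 1) = 2 * (c * d) + c := by ring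
      omega
  · obtain ⟨c, hc⟩ := h.symm.dvd
    have hi : (i : ℤ) = 3 * (c * (d + 1) - 1) := by linarith
    have hc0 : 0 < c := by
      by_contra hc0
      have : c * ((d : ℤ) + 1) ≤ 0 * ((d : ℤ) + 1) :=
        mul_le_mul_of_nonneg_right (by omega) (by omega)
      omega
    lift c to ℕ using hc0.le
    have hc1 : 1 ≤ c := by exact_mod_cast hc0
    have hexp : c * (d + 1) = c * d + c := by ring
    have hi' : i = 3 * (c * (d + 1) - 1) := by
      have : (i : ℤ) + 3 = 3 * ((c * (d + 1) : ℕ) : ℤ) := by push_cast; linarith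
      omega
    have hc2 : 2 ≤ c := by
      by_contra hc2
      obtain rfl : c = 1 := by omega
      apply hne
      omega
    refine Or.inr ⟨c, hc1, hle c ?_, Or.inr ⟨hc2, hi'⟩⟩
    have : c * (2 * d + 1) = 2 * (c * d) + c := by ring
    omega

theorem exists_multisets_card_eq_card_subtype {n : ℕ} (P : n.Partition → Prop)
    [Fintype {p // P p}] : ∃ F : Finset (Multiset ℕ), F.card = Fintype.card {p // P p} ∧
      ∀ s ∈ F, ∃ p, P p ∧ p.parts = s := by
  classical
  refine ⟨Finset.univ.image (fun p : {p // P p} => p.1.parts), ?_, ?_⟩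
  · rw [Finset.card_image_of_injective, Finset.card_univ]
    intro p q h
    exact Subtype.ext (Nat.Partition.ext h)
  · intro s hs
    obtain ⟨p, -, rfl⟩ := Finset.mem_image.1 hs
    exact ⟨p.1, p.2, rfl⟩

theorem exists_multisets_card_eq_congPartitionCountMinus {d m : ℕ} (hd : 1 ≤ d) :
    ∃ F : Finset (Multiset ℕ), F.card = congPartitionCountMinus (3 * d) 3 (3 * m) ∧
      ∀ s ∈ F, s.sum = 3 * m ∧ ∀ i ∈ s, i ∈ levelParts d (2 * m / (2 * d + 1)) := by
  unfold congPartitionCountMinus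
  obtain ⟨F, hF, h⟩ := exists_multisets_card_eq_card_subtype (n := 3 * m) (fun p => ∀ i ∈ p.parts,
    ((i : ℤ) ≡ ((3 : ℕ) : ℤ) [ZMOD (((3 * d : ℕ) : ℤ) + 3)] ∨
      (i : ℤ) ≡ -((3 : ℕ) : ℤ) [ZMOD (((3 * d : ℕ) : ℤ) + 3)]) ∧
        (i : ℤ) ≠ ((3 * d : ℕ) : ℤ) + 3 - ((3 : ℕ) : ℤ))
  refine ⟨F, hF, fun s hs => ?_⟩
  obtain ⟨p, hp, rfl⟩ := h s hs
  refine ⟨p.parts_sum, fun i hi => ?_⟩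
  have hle : i ≤ 3 * m := (Multiset.le_sum_of_mem hi).trans_eq p.parts_sum
  exact mem_levelParts_of_modEq (p.parts_pos hi) (hp i hi).1 (hp i hi).2 hle hd

theorem congPartitionCountMinus_eq_zero {d n : ℕ} (hn : ¬ 3 ∣ n) :
    congPartitionCountMinus (3 * d) 3 n = 0 := by
  unfold congPartitionCountMinus
  rw [Fintype.card_eq_zero_iff]
  refine ⟨fun p => hn ?_⟩
  rw [← p.1.parts_sum]
  refine Multiset.dvd_sum fun i hi => ?_
  have hd : (3 : ℤ) ∣ (((3 * d : ℕ) : ℤ) + 3) := ⟨d + 1, by push_cast; ring⟩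
  have h3 : (3 : ℤ) ∣ i := by
    rcases (p.2 i hi).1 with h | h
    · exact ((h.of_dvd hd).dvd_iff).2 (by norm_num)
    · exact ((h.of_dvd hd).dvd_iff).2 (by norm_num)
  exact_mod_cast h3

/-- In this range only `3` and `3(d+2)` can occur, the latter at most once since `2(d+2) > m`. -/
theorem congPartitionCountMinus_le_two {d m : ℕ} (hd : 1 ≤ d) (hm : m < 2 * d + 1) :
    congPartitionCountMinus (3 * d) 3 (3 * m) ≤ if m < d + 2 then 1 else 2 := by
  obtain ⟨F, hF, h⟩ := exists_multisets_card_eq_congPartitionCountMinus (m := m) hd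
  have hsub : ∀ s ∈ F, s.sum = 3 * m ∧ ∀ i ∈ s, i ∈ insert (3 * (d + 2)) ({3} : Set ℕ) := by
    intro s hs
    refine ⟨(h s hs).1, fun i hi => ?_⟩
    rw [← levelParts_one]
    have hM : 2 * m / (2 * d + 1) ≤ 1 := Nat.lt_succ_iff.1 ((Nat.div_lt_iff_lt_mul (by omega)).2
      (by omega))
    rcases (h s hs).2 i hi with h1 | ⟨c, h1, h2, h3⟩
    · exact Or.inl h1
    · exact Or.inr ⟨c, h1, h2.trans hM, h3⟩
  rw [← hF]
  obtain ⟨F₁, F₂, hcard, h1, h2⟩ := exists_families_of_insert F hsub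
  have hc1 := card_le_one_of_forall_eq (t := 3) (by norm_num) F₁ h1
  have hc2 : F₂.card ≤ 1 := by
    refine card_le_one_of_forall_eq (n := 3 * m - 3 * (d + 2)) (t := 3) (by norm_num) F₂ ?_
    intro s hs
    refine ⟨(h2 s hs).2.1, fun i hi => ?_⟩
    rcases (h2 s hs).2.2 i hi with h3 | h3
    · have := Multiset.le_sum_of_mem hi
      have := (h2 s hs).2.1
      omega
    · exact h3
  split_ifs with hmd
  · have : F₂ = ∅ := by
      rw [Finset.eq_empty_iff_forall_notMem]
      intro s hs
      have := (h2 s hs).1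
      omega
    rw [this, Finset.card_empty] at hcard
    omega
  · omega

theorem congPartitionCountMinus_le (d m : ℕ) (hd : 1 ≤ d) {x : ℝ} (hx0 : 0 < x) (hx1 : x < 1)
    {M : ℕ} (hM : 2 * m / (2 * d + 1) = M) (hM1 : 1 ≤ M) :
    (congPartitionCountMinus (3 * d) 3 (3 * m) : ℝ) ≤
      (1 - x) * (∏ i ∈ Finset.Icc 1 M, ((1 - x ^ i) ^ 2)⁻¹) * x⁻¹ ^ M := by
  obtain ⟨F, hF, h⟩ := exists_multisets_card_eq_congPartitionCountMinus (m := m) hd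
  rw [hM] at h
  have := sumCountBound_levelParts d hx0 hx1 hM1 (3 * m) F h
  rw [← hF]
  convert this using 2
  simp only
  rw [← hM, show 2 * (3 * m) = 3 * (2 * m) by ring, show 6 * d + 3 = 3 * (2 * d + 1) by ring,
    Nat.mul_div_mul_left _ _ (by norm_num)]

/-! ### Analytic estimate of the product. -/

theorem pow_div_one_sub_pow_le {x : ℝ} (hx0 : 0 < x) (hx1 : x < 1) (r : ℕ) :
    x ^ (r + 1) / (1 - x ^ (r + 1)) ≤ x / (1 - x) / (r + 1) := by
  have h1 : x ^ (r + 1) < 1 := pow_lt_one₀ hx0.le hx1 (by omega)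
  have hg : (1 - x) * ((r + 1) * x ^ r) ≤ 1 - x ^ (r + 1) := by
    rw [← mul_neg_geom_sum]
    refine mul_le_mul_of_nonneg_left ?_ (by linarith)
    calc ((r : ℝ) + 1) * x ^ r = ∑ _i ∈ Finset.range (r + 1), x ^ r := by simp
      _ ≤ _ := Finset.sum_le_sum fun i hi =>
        pow_le_pow_of_le_one hx0.le hx1.le (Nat.lt_succ_iff.1 (Finset.mem_range.1 hi))
  rw [div_div, div_le_div_iff₀ (by linarith) (mul_pos (by linarith) (by positivity))]
  calc x ^ (r + 1) * ((1 - x) * (r + 1)) = x * ((1 - x) * ((r + 1) * x ^ r)) := by ring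
    _ ≤ _ := mul_le_mul_of_nonneg_left hg hx0.le

/-- Expanding the logarithms and summing over `i` first leaves at most `∑ x^r / (r(1-x^r))`; each
term is at most `x/(1-x) · 1/r²`, and `ζ(2) = π²/6`. -/
theorem sum_neg_log_one_sub_pow_le {x : ℝ} (hx0 : 0 < x) (hx1 : x < 1) (J : ℕ) :
    ∑ i ∈ Finset.Icc 1 J, -Real.log (1 - x ^ i) ≤ x / (1 - x) * (Real.pi ^ 2 / 6) := by
  have h1 : HasSum (fun r : ℕ => ∑ i ∈ Finset.Icc 1 J, (x ^ i) ^ (r + 1) / ((r : ℝ) + 1))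
      (∑ i ∈ Finset.Icc 1 J, -Real.log (1 - x ^ i)) := by
    refine hasSum_sum fun i hi => Real.hasSum_pow_div_log_of_abs_lt_one ?_
    rw [abs_of_pos (by positivity)]
    exact pow_lt_one₀ hx0.le hx1 (by have := (Finset.mem_Icc.1 hi).1; omega)
  have h2 : HasSum (fun r : ℕ => x / (1 - x) * (1 / ((r : ℝ) + 1) ^ 2))
      (x / (1 - x) * (Real.pi ^ 2 / 6)) := by
    refine HasSum.mul_left _ ?_
    have := (hasSum_nat_add_iff' (f := fun n : ℕ => 1 / (n : ℝ) ^ 2) 1).2 hasSum_zeta_two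
    simpa using this
  refine hasSum_le (fun r => ?_) h1 h2
  have hxr : x ^ (r + 1) < 1 := pow_lt_one₀ hx0.le hx1 (by omega)
  have hgeom : ∑ i ∈ Finset.Icc 1 J, (x ^ i) ^ (r + 1) ≤ x ^ (r + 1) / (1 - x ^ (r + 1)) := by
    have : ∑ i ∈ Finset.Icc 1 J, (x ^ i) ^ (r + 1)
        = x ^ (r + 1) * ∑ i ∈ Finset.range J, (x ^ (r + 1)) ^ i := by
      clear h1
      induction J with
      | zero => simp
      | succ J ih =>
        rw [Finset.sum_Icc_succ_top (by omega), Finset.sum_range_succ, mul_add]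
        rw [ih]
        ring
    rw [this, div_eq_mul_inv]
    refine mul_le_mul_of_nonneg_left ?_ (by positivity)
    rw [← tsum_geometric_of_lt_one (by positivity) hxr]
    exact (summable_geometric_of_lt_one (by positivity) hxr).sum_le_tsum _
      (fun i _ => by positivity)
  rw [← Finset.sum_div]
  calc (∑ i ∈ Finset.Icc 1 J, (x ^ i) ^ (r + 1)) / ((r : ℝ) + 1)
      ≤ x / (1 - x) / (r + 1) / (r + 1) := by
        gcongr
        exact hgeom.trans (pow_div_one_sub_pow_le hx0 hx1 r)
    _ = _ := by
        have : (1 - x) ≠ 0 := by linarith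
        field_simp

theorem prod_inv_one_sub_pow_sq_le {x : ℝ} (hx0 : 0 < x) (hx1 : x < 1) (J : ℕ) :
    ∏ i ∈ Finset.Icc 1 J, ((1 - x ^ i) ^ 2)⁻¹ ≤ Real.exp (x / (1 - x) * (Real.pi ^ 2 / 3)) := by
  have h : ∏ i ∈ Finset.Icc 1 J, ((1 - x ^ i) ^ 2)⁻¹
      = Real.exp (2 * ∑ i ∈ Finset.Icc 1 J, -Real.log (1 - x ^ i)) := by
    rw [Finset.mul_sum, Real.exp_sum]
    refine Finset.prod_congr rfl fun i hi => ?_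
    have hxi : x ^ i < 1 :=
      pow_lt_one₀ hx0.le hx1 (by have := (Finset.mem_Icc.1 hi).1; omega)
    rw [show 2 * -Real.log (1 - x ^ i) = -((2 : ℕ) * Real.log (1 - x ^ i)) by push_cast; ring,
      Real.exp_neg, Real.exp_nat_mul, Real.exp_log (by linarith)]
  rw [h]
  refine Real.exp_le_exp.2 ?_
  have := sum_neg_log_one_sub_pow_le hx0 hx1 J
  linarith

/-! ### Numerical inequalities. -/

theorem exp_pi_sq_div_six_le : Real.exp (Real.pi ^ 2 / 6) ≤ Real.exp (33 / 20) := by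
  refine Real.exp_le_exp.2 ?_
  have h1 := Real.pi_lt_d4
  have h2 := Real.pi_pos
  nlinarith

theorem exp_le_39 : Real.exp (73 / 20) ≤ 39 := by
  have h : Real.exp (73 / 20) ^ 20 ≤ 39 ^ 20 := by
    rw [← Real.exp_nat_mul, show ((20 : ℕ) : ℝ) * (73 / 20) = (73 : ℕ) * 1 by norm_num,
      Real.exp_nat_mul]
    calc Real.exp 1 ^ 73 ≤ 2.7182818286 ^ 73 :=
          pow_le_pow_left₀ (Real.exp_pos _).le Real.exp_one_lt_d9.le _
      _ ≤ _ := by norm_num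
  exact le_of_pow_le_pow_left₀ (by norm_num) (by norm_num) h

theorem exp_le_736 : Real.exp (33 / 5) ≤ 736 := by
  have h : Real.exp (33 / 5) ^ 5 ≤ 736 ^ 5 := by
    rw [← Real.exp_nat_mul, show ((5 : ℕ) : ℝ) * (33 / 5) = (33 : ℕ) * 1 by norm_num,
      Real.exp_nat_mul]
    calc Real.exp 1 ^ 33 ≤ 2.7182818286 ^ 33 :=
          pow_le_pow_left₀ (Real.exp_pos _).le Real.exp_one_lt_d9.le _
      _ ≤ _ := by norm_num
  exact le_of_pow_le_pow_left₀ (by norm_num) (by norm_num) h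

theorem two_mul_pow_le_add_one_pow {y : ℝ} {n : ℕ} (hy : 0 < y) (hn : y ≤ n) :
    2 * y ^ n ≤ (y + 1) ^ n := by
  have h := one_add_mul_le_pow (a := 1 / y) (by have : 0 < 1 / y := by positivity
                                                linarith) n
  have h1 : 1 ≤ n * (1 / y) := by
    rw [mul_one_div, one_le_div hy]; exact hn
  calc 2 * y ^ n ≤ (1 + 1 / y) ^ n * y ^ n :=
        mul_le_mul_of_nonneg_right (by linarith) (by positivity)
    _ = (y + 1) ^ n := by
        rw [← mul_pow]
        congr 1
        field_simp

/-- The final comparison for `M ≥ 16`. It fails at `j = 2`, hence the separate treatment of `9 ≤ M ≤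
15`. The induction step gains a factor `4` from two uses of `two_mul_pow_le_add_one_pow`. -/
theorem pow_mul_factorial_le {j : ℕ} (hj : 3 ≤ j) :
    (39 : ℝ) ^ (j + 2) * ((j + 2).factorial * (j + 1).factorial) ≤
      4 * (93 / 2 * ((j + 1) * j)) ^ (j + 1) := by
  induction j, hj using Nat.le_induction with
  | base => norm_num [Nat.factorial]
  | succ j hj ih =>
    have hj0 : (3 : ℝ) ≤ j := by exact_mod_cast hj
    have h1 := two_mul_pow_le_add_one_pow (y := j) (n := j + 1) (by linarith) (by push_cast; linarith)
    have h2 := two_mul_pow_le_add_one_pow (y := j + 1) (n := j + 1) (by linarith)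
      (by push_cast; linarith)
    have hf2 : ((j + 2).factorial : ℝ) = (j + 2) * (j + 1).factorial := by
      rw [Nat.factorial_succ (j + 1)]
      push_cast
      ring
    have hf3 : ((j + 3).factorial : ℝ) = (j + 3) * (j + 2).factorial := by
      rw [Nat.factorial_succ (j + 2)]
      push_cast
      ring
    push_cast
    change (39 : ℝ) ^ (j + 1 + 2) * ((j + 3).factorial * (j + 2).factorial) ≤ _
    have h4 : 4 * (((j : ℝ) + 1) * j) ^ (j + 1) ≤ (((j : ℝ) + 1 + 1) * (j + 1)) ^ (j + 1) := by
      rw [mul_pow, mul_pow]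
      calc 4 * (((j : ℝ) + 1) ^ (j + 1) * (j : ℝ) ^ (j + 1))
          = (2 * ((j : ℝ) + 1) ^ (j + 1)) * (2 * (j : ℝ) ^ (j + 1)) := by ring
        _ ≤ _ := mul_le_mul h2 h1 (by positivity) (by positivity)
    set P : ℝ := (((j : ℝ) + 1) * j) ^ (j + 1) with hP
    set R : ℝ := (((j : ℝ) + 1 + 1) * (j + 1)) ^ (j + 1) with hR
    rw [mul_pow, ← hP] at ih
    have hPpos : 0 ≤ P := by positivity
    calc (39 : ℝ) ^ (j + 1 + 2) * ((j + 3).factorial * (j + 2).factorial)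
        = 39 * ((j + 3) * (j + 2)) *
            (39 ^ (j + 2) * ((j + 2).factorial * (j + 1).factorial)) := by
          rw [hf3, hf2]
          ring
      _ ≤ 39 * ((j + 3) * (j + 2)) * (4 * ((93 / 2) ^ (j + 1) * P)) :=
          mul_le_mul_of_nonneg_left ih (by positivity)
      _ = (39 * (j + 3)) * ((j + 2) * (93 / 2) ^ (j + 1) * 4 * P) := by ring
      _ ≤ (93 / 2 * 4 * (j + 1)) * ((j + 2) * (93 / 2) ^ (j + 1) * 4 * P) :=
          mul_le_mul_of_nonneg_right (by linarith) (by positivity)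
      _ = 4 * (93 / 2) ^ (j + 2) * ((j + 2) * (j + 1)) * (4 * P) := by ring
      _ ≤ 4 * (93 / 2) ^ (j + 2) * ((j + 2) * (j + 1)) * R :=
          mul_le_mul_of_nonneg_left h4 (by positivity)
      _ = 4 * (93 / 2 * (((j : ℝ) + 1 + 1) * (j + 1))) ^ (j + 1 + 1) := by
          rw [mul_pow, pow_succ (((j : ℝ) + 1 + 1) * (j + 1)), ← hR]
          ring

/-! ### Explicit upper bounds in `k`. -/

theorem congPartitionCountMinus_le_exp {d m M k : ℕ} (hd : 1 ≤ d) (hM : 2 * m / (2 * d + 1) = M)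
    (hM1 : 1 ≤ M) (hk : 1 ≤ k) :
    (congPartitionCountMinus (3 * d) 3 (3 * m) : ℝ) ≤
      2 / (k + 2) * Real.exp (33 / 20 * k) * (1 + 2 / k) ^ M := by
  have hk0 : (0 : ℝ) < k := by exact_mod_cast hk
  have hx0 : (0 : ℝ) < k / (k + 2) := by positivity
  have hx1 : (k : ℝ) / (k + 2) < 1 := by rw [div_lt_one (by positivity)]; linarith
  have h1x : 1 - (k : ℝ) / (k + 2) = 2 / (k + 2) := by field_simp; ring
  have hinv : ((k : ℝ) / (k + 2))⁻¹ = 1 + 2 / k := by field_simp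
  have hexp : Real.exp ((k : ℝ) / (k + 2) / (1 - (k : ℝ) / (k + 2)) * (Real.pi ^ 2 / 3))
      ≤ Real.exp (33 / 20 * k) := by
    have h6 := Real.exp_le_exp.1 exp_pi_sq_div_six_le
    refine Real.exp_le_exp.2 ?_
    rw [h1x]
    have : (k : ℝ) / (k + 2) / (2 / (k + 2)) * (Real.pi ^ 2 / 3) = Real.pi ^ 2 / 6 * k := by
      field_simp
      ring
    rw [this]
    exact mul_le_mul_of_nonneg_right h6 hk0.le
  have h := congPartitionCountMinus_le d m hd hx0 hx1 hM hM1
  have hp := (prod_inv_one_sub_pow_sq_le hx0 hx1 M).trans hexp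
  rw [hinv] at h
  refine h.trans ?_
  rw [h1x]
  gcongr

/-- The base comes from `exp(2 + 33/20) ≤ 39`. The inequality `2/(k+2) ≤ (1 + 2/k)/4` supplies the
`1/4` at the cost of one more factor `1 + 2/k`, which `M + 1 ≤ k²` accommodates. -/
theorem congPartitionCountMinus_le_pow {d m M k : ℕ} (hd : 1 ≤ d)
    (hM : 2 * m / (2 * d + 1) = M) (hM1 : 1 ≤ M) (hk : 1 ≤ k) (hMk : M + 1 ≤ k ^ 2) :
    (congPartitionCountMinus (3 * d) 3 (3 * m) : ℝ) ≤ 39 ^ k / 4 := by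
  have hk0 : (0 : ℝ) < k := by exact_mod_cast hk
  have h := congPartitionCountMinus_le_exp hd hM hM1 hk
  have h2 : (1 + 2 / (k : ℝ)) ^ M * (1 + 2 / k) ≤ Real.exp (2 * k) := by
    rw [← pow_succ]
    have h1 : (1 : ℝ) ≤ 1 + 2 / k := by
      have : (0 : ℝ) < 2 / k := by positivity
      linarith
    calc (1 + 2 / (k : ℝ)) ^ (M + 1) ≤ (1 + 2 / (k : ℝ)) ^ (k ^ 2) := pow_le_pow_right₀ h1 hMk
      _ ≤ Real.exp (2 / k) ^ (k ^ 2) := by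
          refine pow_le_pow_left₀ (by positivity) ?_ _
          rw [add_comm]
          exact Real.add_one_le_exp _
      _ = Real.exp (2 * k) := by
          rw [← Real.exp_nat_mul]
          congr 1
          push_cast
          field_simp
  have h3 : Real.exp (2 * k) * Real.exp (33 / 20 * k) ≤ 39 ^ k := by
    rw [← Real.exp_add, show 2 * (k : ℝ) + 33 / 20 * k = k * (73 / 20) by ring, Real.exp_nat_mul]
    exact pow_le_pow_left₀ (Real.exp_pos _).le exp_le_39 _
  have h4 : 2 / ((k : ℝ) + 2) ≤ 1 / 4 * (1 + 2 / k) := by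
    have : 1 / 4 * (1 + 2 / (k : ℝ)) - 2 / (k + 2) = (k - 2) ^ 2 / (4 * k * (k + 2)) := by
      field_simp
      ring
    have h5 : (0 : ℝ) ≤ (k - 2) ^ 2 / (4 * k * (k + 2)) := by positivity
    linarith
  calc (congPartitionCountMinus (3 * d) 3 (3 * m) : ℝ)
      ≤ 2 / (k + 2) * Real.exp (33 / 20 * k) * (1 + 2 / k) ^ M := h
    _ ≤ 1 / 4 * (1 + 2 / k) * Real.exp (33 / 20 * k) * (1 + 2 / k) ^ M := by gcongr
    _ = 1 / 4 * (((1 + 2 / k) ^ M * (1 + 2 / k)) * Real.exp (33 / 20 * k)) := by ring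
    _ ≤ 1 / 4 * (Real.exp (2 * k) * Real.exp (33 / 20 * k)) := by gcongr
    _ ≤ 1 / 4 * 39 ^ k := by gcongr
    _ = 39 ^ k / 4 := by ring

/-! ### Comparison in each range of `M`. -/

theorem exists_excess {d m M j : ℕ} (hd : 31 ≤ d) (hM : M * (2 * d + 1) ≤ 2 * m) (hj : 2 ≤ j)
    (hMj : (j + 1) ^ 2 ≤ M) :
    ∃ N, 3 * m = N + (j + 1 + 1) * 3 + 3 * d * (j + 1 + 1).choose 2 ∧
      93 * ((j + 1) * j) ≤ 2 * N := by
  have hT : 2 * (j + 1 + 1).choose 2 = (j + 2) * (j + 1) := by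
    rw [Nat.choose_two_right, Nat.mul_div_cancel' (Nat.even_mul_pred_self _).two_dvd]
    rfl
  generalize (j + 1 + 1).choose 2 = T at hT
  have h1 : (j + 1) ^ 2 * (2 * d + 1) ≤ 2 * m := (Nat.mul_le_mul_right _ hMj).trans hM
  have h2 : 31 * ((j + 1) * j) ≤ d * ((j + 1) * j) := Nat.mul_le_mul_right _ hd
  have h3 : d * (2 * T) = d * ((j + 2) * (j + 1)) := by rw [hT]
  have h4 : 2 * j ≤ j * j := Nat.mul_le_mul_right _ hj
  -- Since `2(j+1)² - (j+2)(j+1) = (j+1)j`, twice the excess is at least `3d(j+1)j + 3(j² - 3)`, and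
  -- `3d ≥ 93`.
  have h5 : 93 * ((j + 1) * j) + 2 * ((j + 1 + 1) * 3 + 3 * d * T) ≤ 2 * (3 * m) := by
    nlinarith
  refine ⟨3 * m - ((j + 1 + 1) * 3 + 3 * d * T), ?_, ?_⟩ <;> omega

theorem congCount_le_gapCount_of_large {d m M : ℕ} (hd : 31 ≤ d) (hM : 2 * m / (2 * d + 1) = M) (hM16 : 16 ≤ M) :
    congPartitionCountMinus (3 * d) 3 (3 * m) ≤ gapPartitionCount (3 * d) 3 (3 * m) := by
  obtain ⟨j, hj⟩ : ∃ j, M.sqrt = j + 1 :=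
    Nat.exists_eq_add_one.2 (Nat.sqrt_pos.2 (by omega))
  have hlo : (j + 1) ^ 2 ≤ M := hj ▸ Nat.sqrt_le' M
  have hhi : M + 1 ≤ (j + 2) ^ 2 := by
    have := Nat.lt_succ_sqrt' M
    rw [hj] at this
    exact this
  have hj3 : 3 ≤ j := by
    by_contra hlt
    have : (j + 2) ^ 2 ≤ 4 ^ 2 := Nat.pow_le_pow_left (by omega) 2
    omega
  have hMm : M * (2 * d + 1) ≤ 2 * m := hM ▸ Nat.div_mul_le_self _ _
  obtain ⟨N, hN, hN2⟩ := exists_excess hd hMm (by omega) hlo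
  have hq := pow_le_gapPartitionCount (D := 3 * d) (a := 3) (by omega) (by norm_num) (j + 1) N _ hN
  -- With `j + 1 = ⌊√M⌋`, the value `j + 2` is both the number of parts on the gap side and the
  -- least `k` allowed by `M + 1 ≤ k²`.
  have hU := congPartitionCountMinus_le_pow (k := j + 2) (by omega) hM (by omega) (by omega) hhi
  have hL := pow_mul_factorial_le hj3
  have hN3 : (93 / 2 * (((j : ℝ) + 1) * j)) ≤ N := by
    have : (93 : ℝ) * ((j + 1) * j) ≤ 2 * N := by exact_mod_cast hN2
    linarith
  have hN4 : (93 / 2 * (((j : ℝ) + 1) * j)) ^ (j + 1) ≤ (N : ℝ) ^ (j + 1) :=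
    pow_le_pow_left₀ (by positivity) hN3 _
  have hq' : (N : ℝ) ^ (j + 1) ≤ ((j + 2).factorial * (j + 1).factorial : ℝ) *
      gapPartitionCount (3 * d) 3 (3 * m) := by exact_mod_cast hq
  have hf : (0 : ℝ) < (j + 2).factorial * (j + 1).factorial := by positivity
  have hfin : (39 : ℝ) ^ (j + 2) / 4 ≤ gapPartitionCount (3 * d) 3 (3 * m) := by
    refine le_of_mul_le_mul_left ?_ hf
    linarith
  exact_mod_cast hU.trans hfin

theorem congCount_le_gapCount_of_medium {d m M : ℕ} (hd : 31 ≤ d) (hM : 2 * m / (2 * d + 1) = M) (hM9 : 9 ≤ M)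
    (hM16 : M < 16) :
    congPartitionCountMinus (3 * d) 3 (3 * m) ≤ gapPartitionCount (3 * d) 3 (3 * m) := by
  have hMm : M * (2 * d + 1) ≤ 2 * m := hM ▸ Nat.div_mul_le_self _ _
  obtain ⟨N, hN, hN2⟩ := exists_excess (j := 2) hd hMm le_rfl (by omega)
  have hq := pow_le_gapPartitionCount (D := 3 * d) (a := 3) (by omega) (by norm_num) 3 N _ hN
  have hN3 : 279 ^ 3 ≤ N ^ 3 := Nat.pow_le_pow_left (by omega) 3
  -- Four parts with excess at least `279` give `279³/(4!·3!) > 150000`.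
  have hq' : 150000 ≤ gapPartitionCount (3 * d) 3 (3 * m) := by
    norm_num [Nat.factorial] at hq
    omega
  have hU := congPartitionCountMinus_le_exp (k := 4) (by omega) hM (by omega) (by omega)
  have h1 : (1 + 2 / ((4 : ℕ) : ℝ)) ^ M ≤ (3 / 2) ^ 15 := by
    rw [show (1 + 2 / ((4 : ℕ) : ℝ)) = 3 / 2 by norm_num]
    exact pow_le_pow_right₀ (by norm_num) (by omega)
  have h2 : Real.exp (33 / 20 * (4 : ℕ)) ≤ 736 := by
    rw [show (33 / 20 * (4 : ℕ) : ℝ) = 33 / 5 by norm_num]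
    exact exp_le_736
  have hU' : (congPartitionCountMinus (3 * d) 3 (3 * m) : ℝ) ≤ 150000 := by
    refine hU.trans ?_
    calc 2 / (((4 : ℕ) : ℝ) + 2) * Real.exp (33 / 20 * (4 : ℕ)) * (1 + 2 / ((4 : ℕ) : ℝ)) ^ M
        ≤ 2 / (((4 : ℕ) : ℝ) + 2) * 736 * (3 / 2) ^ 15 := by gcongr
      _ ≤ 150000 := by norm_num
  have : congPartitionCountMinus (3 * d) 3 (3 * m) ≤ 150000 := by exact_mod_cast hU'
  omega

theorem congPartitionCountMinus_le_of_le_eight {d m M : ℕ} (hd : 1 ≤ d)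
    (hM : 2 * m / (2 * d + 1) = M) (hM1 : 1 ≤ M) (hM8 : M ≤ 8) :
    congPartitionCountMinus (3 * d) 3 (3 * m) ≤ 6 * 2 ^ M := by
  have h := congPartitionCountMinus_le d m hd (x := 1 / 2) (by norm_num) (by norm_num) hM hM1
  have h2 : (1 - 1 / 2 : ℝ) * (∏ i ∈ Finset.Icc 1 M, ((1 - (1 / 2 : ℝ) ^ i) ^ 2)⁻¹) ≤ 6 := by
    -- Even the infinite product at `x = 1/2` is just below `12`.
    interval_cases M <;> norm_num [Finset.prod_Icc_succ_top]
  have h3 : (congPartitionCountMinus (3 * d) 3 (3 * m) : ℝ) ≤ 6 * 2 ^ M := by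
    refine h.trans ?_
    rw [show ((1 / 2 : ℝ))⁻¹ = 2 by norm_num]
    exact mul_le_mul_of_nonneg_right h2 (by positivity)
  exact_mod_cast h3

theorem congCount_le_gapCount_of_small {d m M : ℕ} (hd : 31 ≤ d) (hM : 2 * m / (2 * d + 1) = M) (hM2 : 2 ≤ M)
    (hM9 : M < 9) :
    congPartitionCountMinus (3 * d) 3 (3 * m) ≤ gapPartitionCount (3 * d) 3 (3 * m) := by
  have hMm : M * (2 * d + 1) ≤ 2 * m := hM ▸ Nat.div_mul_le_self _ _
  have hU := congPartitionCountMinus_le_of_le_eight (by omega) hM (by omega) (by omega)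
  have hc2 : Nat.choose 2 2 = 1 := rfl
  have hc3 : Nat.choose 3 2 = 3 := rfl
  rcases Nat.lt_or_ge M 5 with h5 | h5
  · have hq := pow_le_gapPartitionCount (D := 3 * d) (a := 3) (by omega) (by norm_num) 1
      (3 * m - 6 - 3 * d) (3 * m) (by
        have : 2 * (2 * d + 1) ≤ M * (2 * d + 1) := Nat.mul_le_mul_right _ hM2
        rw [hc2]; omega)
    norm_num [Nat.factorial] at hq
    interval_cases M <;> omega
  · have h5m : 5 * (2 * d + 1) ≤ M * (2 * d + 1) := Nat.mul_le_mul_right _ h5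
    have hq := pow_le_gapPartitionCount (D := 3 * d) (a := 3) (by omega) (by norm_num) 2
      (3 * m - 9 - 9 * d) (3 * m) (by rw [hc3]; omega)
    -- From `M ≥ 5` the excess of three parts is at least `6d ≥ 186`, and `185²/12` exceeds `6·2^8`.
    have hN : 185 ^ 2 ≤ (3 * m - 9 - 9 * d) ^ 2 := Nat.pow_le_pow_left (by omega) 2
    norm_num [Nat.factorial] at hq
    have : 2 ^ M ≤ 2 ^ 8 := Nat.pow_le_pow_right (by norm_num) (by omega)
    omega

theorem congCount_le_gapCount_of_lt {d m : ℕ} (hd : 1 ≤ d) (hm0 : 1 ≤ m) (hm : m < 2 * d + 1) :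
    congPartitionCountMinus (3 * d) 3 (3 * m) ≤ gapPartitionCount (3 * d) 3 (3 * m) := by
  refine (congPartitionCountMinus_le_two hd hm).trans ?_
  have h1 : IsGapList (3 * d) 1 3 (3 * m) [3 * m] := by simp [IsGapList]; omega
  split_ifs with h
  · refine card_le_gapPartitionCount (by omega) (by norm_num) {[3 * m]} fun l hl => ⟨1, ?_⟩
    rw [Finset.mem_singleton.1 hl]
    exact h1
  · have h2 : IsGapList (3 * d) 2 3 (3 * m) [3, 3 * m - 3] := by
      simp [IsGapList]; omega
    have hcard : ({[3 * m], [3, 3 * m - 3]} : Finset (List ℕ)).card = 2 :=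
      Finset.card_pair (by simp)
    rw [← hcard]
    refine card_le_gapPartitionCount (by omega) (by norm_num) _ fun l hl => ?_
    rcases Finset.mem_insert.1 hl with rfl | hl
    · exact ⟨1, h1⟩
    · rw [Finset.mem_singleton.1 hl]
      exact ⟨2, h2⟩

theorem mainTheorem8 (d n : ℕ) (hd : 31 ≤ d) (hn : d + 6 ≤ n) :
    0 ≤ deltaMinus (3 * d) 3 3 n := by
  unfold deltaMinus
  rw [sub_nonneg, Nat.cast_le]
  by_cases h3 : 3 ∣ n
  · obtain ⟨m, rfl⟩ := h3
    rcases Nat.lt_or_ge (2 * m / (2 * d + 1)) 2 with h2 | h2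
    · rw [Nat.div_lt_iff_lt_mul (by omega)] at h2
      exact congCount_le_gapCount_of_lt (by omega) (by omega) (by omega)
    rcases Nat.lt_or_ge (2 * m / (2 * d + 1)) 9 with h9 | h9
    · exact congCount_le_gapCount_of_small hd rfl h2 h9
    rcases Nat.lt_or_ge (2 * m / (2 * d + 1)) 16 with h16 | h16
    · exact congCount_le_gapCount_of_medium hd rfl h9 h16
    · exact congCount_le_gapCount_of_large hd rfl h16
  · rw [congPartitionCountMinus_eq_zero h3]
    exact Nat.zero_le _
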